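/- **Setting.** A *polyomino* $P$ is a finite set of unit cells of the square grid; two cells are adjacent in $P$ if they share an edge in the plane. A *box* $B$ is $[0,a]\times[0,b]\times[0,c]$ with positive integers $a,b,c$; its surface is divided into $2(ab+bc+ca)$ unit squares, and two distinct squares are adjacent if they share an edge. We also write $B$ for the set of these squares. A *folding* of $P$ into $B$ moves each cell rigidly onto a unit square of the surface of $B$, such that adjacent cells stay attached along their common edge, the upper side of $P$ becomes the outer side of $B$, and each square of $B$ is covered by exactly one cell. It induces a bijection $F:P\to B$ and the set of *cut edges* $C=\{\{s,t\} : s,t \text{ adjacent in } B,\ F^{-1}(s),F^{-1}(t)\text{ not adjacent in }P\}$. Label each square of $B$ by a dot at its corner farthest from the origin. Number the edges of a square $0,1,2,3$ counterclockwise as seen from outside, where edge $0$ is the one that ends at the dot in counterclockwise order; number the corners of a planar cell $0,1,2,3$ (upper right, upper left, lower left, lower right). All these numbers are taken in $\mathbb Z_4$. The *orientation* $o(s)\in\mathbb{Z}_4$ of a square $s$ induced by the folding is the number of the corner of the cell $F^{-1}(s)$ that is folded onto the dot of $s$. If edge $k$ of $s$ is edge $j$ of $t\ne s$, put $r_s(t)=k+2-j$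 (the orientation of $t$ when $s$ is laid in the plane with orientation $0$). **The constraints $\mathrm{EQUIV}_{B_1,B_2}$.** Let $C_1,C_2$ be sets of cut edges of $B_1,B_2$; write $e_{s,t}$ for "$\{s,t\}$ is not cut". The Boolean variables are $o_{s,d}$ ($s\in B_1\cup B_2$, taken as a disjoint union), $m_{s,s'}$ and $\rho_{s,r}$ ($s\in B_1$, $s'\in B_2$, $d,r\in\mathbb Z_4$). The constraints are: 1. $m$ encodes a bijection $B_2\to B_1$: for each $s'$ exactly one $m_{s,s'}$ is true, and for each $s$ exactly one $m_{s,s'}$ is true; 2. for each $s\in B_1$ exactly one $\rho_{s,r}$ is true, and $m_{s,s'}\wedge o_{s',d+r}\wedge o_{s,d}\rightarrow\rho_{s,r}$; 3. whenever $s_2$ is the neighbor of $s_1\in B_1$ across edge $k$ of $s_1$, and $s_2'$ is the neighbor of $s_1'\in B_2$ across edge $k-r$ of $s_1'$ (the neighbor in the same direction of the plane, if the orientations of $s_1$ and $s_1'$ differ by $r$): $$m_{s_1,s_1'}\wedge\rho_{s_1,r}\wedge e_{s_1,s_2}\rightarrow m_{s_2,s_2'},\quad m_{s_1,s_1'}\wedge\rho_{s_1,r}\wedge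 e_{s_1,s_2}\rightarrow e_{s_1',s_2'},\quad m_{s_1,s_1'}\wedge\rho_{s_1,r}\wedge e_{s_1',s_2'}\rightarrow e_{s_1,s_2}.$$ **Theorem.** Suppose that a polyomino $P$ folds into boxes $B_1$ and $B_2$, with induced bijections $F_i:P\to B_i$ and cut edges $C_i$. Then the foldings induce well-defined orientations $o_i:B_i\to\mathbb Z_4$, and these satisfy the square orientation constraints: $o_i(t)=o_i(s)+r_s(t)$ for all adjacent $s,t\in B_i$ whose common edge is not in $C_i$. Moreover, the constraints $\mathrm{EQUIV}_{B_1,B_2}$ with cut edges $(C_1,C_2)$ are satisfied by the assignment given by $o_1$, $o_2$, the bijection $M=F_1\circ F_2^{-1}:B_2\to B_1$ and the shifts $\rho:B_1\to\mathbb Z_4$, $\rho(M(s'))=o_2(s')-o_1(M(s'))$; that is, $m_{s,s'}$ is true iff $M(s')=s$, $\rho_{s,r}$ is true iff $\rho(s)=r$, and $o_{s,d}$ is true iff $o_i(s)=d$ (for $s\in B_i$). -/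

import Mathlib

open scoped Matrix

/-! ### The plane: unit cells and polyominoes -/

/-- The corners of a unit square `[0,1] × [0,1]`, numbered counterclockwise modulo `4`, starting
from the upper right corner: `0 ↦ (1,1)`, `1 ↦ (0,1)`, `2 ↦ (0,0)`, `3 ↦ (1,0)`. -/
def unitCorner (q : ZMod 4) : ℤ × ℤ :=
  (if q = 0 ∨ q = 3 then 1 else 0, if q = 0 ∨ q = 1 then 1 else 0)

/-- The grid graph on `ℤ²`: two lattice points are adjacent when their `ℓ¹`-distance is `1`. -/
def gridGraph : SimpleGraph (ℤ × ℤ) where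
  Adj p q := |p.1 - q.1| + |p.2 - q.2| = 1
  symm := ⟨fun p q h => by rw [abs_sub_comm q.1 p.1, abs_sub_comm q.2 p.2]; exact h⟩
  loopless := ⟨fun p h => by simp at h⟩

/-- A polyomino: a finite set of cells of the square grid, seen as a finite induced subgraph of the
grid graph. The cell `p` is the unit square with lower left corner `p`. (Connectedness is not part
of the definition; connected polyominoes are a special case.) -/
structure Polyomino where
  cells : Finset (ℤ × ℤ)

namespace Polyomino

/-- The cells of a polyomino, as a type. -/
abbrev Cell (P : Polyomino) : Type := {p : ℤ × ℤ // p ∈ P.cells}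

/-- The graph of a polyomino: the subgraph of the grid graph induced by its cells. -/
def graph (P : Polyomino) : SimpleGraph P.Cell := gridGraph.comap Subtype.val

end Polyomino

/-- The closed unit square of the plane with lower left corner `p`. -/
def cellRegion (p : ℤ × ℤ) : Set (ℝ × ℝ) :=
  Set.Icc (p.1 : ℝ) (p.1 + 1) ×ˢ Set.Icc (p.2 : ℝ) (p.2 + 1)

/-- The corner number `q` of the cell `p`, as a point of the plane. -/
def cellCorner (p : ℤ × ℤ) (q : ZMod 4) : ℝ × ℝ :=
  (((p.1 + (unitCorner q).1 : ℤ) : ℝ), ((p.2 + (unitCorner q).2 : ℤ) : ℝ))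

/-! ### Boxes, their unit squares, and the canonical labelling -/

/-- A box with positive integer side lengths, placed in the positive octant as
`[0, dim 0] × [0, dim 1] × [0, dim 2]`. -/
structure Box where
  dim : Fin 3 → ℕ
  dim_pos : ∀ i, 0 < dim i

/-- A unit square of the surface of a box: a lattice unit square orthogonal to the direction `axis`
whose corner closest to the origin is `corner`, lying in one of the two faces orthogonal to
`axis`. -/
@[ext]
structure Box.Square (B : Box) where
  axis : Fin 3
  corner : Fin 3 → ℤ
  on_face : corner axis = 0 ∨ corner axis = B.dim axis
  in_face : ∀ i, i ≠ axis → 0 ≤ corner i ∧ corner i < B.dim i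

namespace Box.Square

variable {B : Box}

/-- The square as a subset of space. -/
def region (s : B.Square) : Set (Fin 3 → ℝ) :=
  {x | x s.axis = s.corner s.axis ∧
    ∀ i, i ≠ s.axis → x i ∈ Set.Icc (s.corner i : ℝ) (s.corner i + 1)}

/-- The unit normal vector of the square that points out of the box. -/
def normal (s : B.Square) : Fin 3 → ℤ :=
  if s.corner s.axis = 0 then -Pi.single s.axis 1 else Pi.single s.axis 1

/-- The dot of the square: its corner that is farthest from the origin. -/
def dot (s : B.Square) : Fin 3 → ℤ :=
  fun i => if i = s.axis then s.corner i else s.corner i + 1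

/-- The two edge vectors `u`, `v` of the square at `corner`, ordered such that `u × v` is the
outward normal. -/
def frame (s : B.Square) : (Fin 3 → ℤ) × (Fin 3 → ℤ) :=
  if s.corner s.axis = 0 then (Pi.single (s.axis + 2) 1, Pi.single (s.axis + 1) 1)
  else (Pi.single (s.axis + 1) 1, Pi.single (s.axis + 2) 1)

/-- The four vertices of the square, numbered counterclockwise as seen from outside the box,
starting with the dot. -/
def vertex (s : B.Square) (q : ZMod 4) : Fin 3 → ℤ :=
  s.corner + (unitCorner q).1 • s.frame.1 + (unitCorner q).2 • s.frame.2

/-- The numbering of the vertices starts with the dot. -/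
theorem vertex_zero (s : B.Square) : s.vertex 0 = s.dot := by
  obtain ⟨k, c, h1, h2⟩ := s
  funext i
  by_cases h : c k = 0 <;> fin_cases k <;> fin_cases i <;>
    simp_all [vertex, dot, frame, unitCorner]

/-- The edge number `k` of the square. When the square lies in the plane with its outer side up and
its dot in the upper right corner, the edges number `0`, `1`, `2`, `3` are the right, upper, left
and lower one. -/
def edge (s : B.Square) (k : ZMod 4) : Sym2 (Fin 3 → ℤ) := s(s.vertex (k - 1), s.vertex k)

/-- `t` is the neighbor of `s` across the edge number `k` of `s`. -/
def IsNeighbor (s : B.Square) (k : ZMod 4) (t : B.Square) : Prop :=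
  s ≠ t ∧ ∃ j, t.edge j = s.edge k

/-- `r` is the relative orientation `r_s(t)` of the neighbor `t` of `s`: if the edge number `k` of
`s` is the edge number `j` of `t`, and `s` is laid in the plane with orientation `0`, then `t` lies
in the direction `k` of `s` and its edge number `j` faces the opposite direction `k + 2`. -/
def IsRelOrientation (s t : B.Square) (r : ZMod 4) : Prop :=
  s ≠ t ∧ ∃ k j, t.edge j = s.edge k ∧ r = k + 2 - j

end Box.Square

/-- The adjacency graph of the unit squares of a box: two squares are adjacent when they share an
edge. -/
def Box.graph (B : Box) : SimpleGraph B.Square where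
  Adj s t := s ≠ t ∧ ∃ k j, t.edge j = s.edge k
  symm := ⟨fun _ _ ⟨h, k, j, e⟩ => ⟨h.symm, j, k, e.symm⟩⟩
  loopless := ⟨fun _ h => h.1 rfl⟩

/-! ### Foldings -/

/-- A rigid placement of the plane in space: `x ↦ origin + x₁ u + x₂ v` with `u`, `v`
orthonormal. -/
structure Placement where
  origin : Fin 3 → ℝ
  u : Fin 3 → ℝ
  v : Fin 3 → ℝ
  u_unit : u ⬝ᵥ u = 1
  v_unit : v ⬝ᵥ v = 1
  u_orth_v : u ⬝ᵥ v = 0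

/-- The position in space of a point of the plane. -/
def Placement.map (T : Placement) (x : ℝ × ℝ) : Fin 3 → ℝ :=
  T.origin + x.1 • T.u + x.2 • T.v

/-- A folding of the polyomino `P` (along grid lines) into the box `B`: each cell is moved rigidly
onto a unit square of the surface of the box, cells with a common edge stay attached along it, the
upper side of the polyomino becomes the outer side of the box, and each unit square of the
box is covered by exactly one cell. -/
structure Folding (P : Polyomino) (B : Box) where
  /-- the rigid motion of each cell -/
  place : P.Cell → Placement
  /-- the induced bijection from the cells of `P` to the squares of `B` -/
  square : P.Cell ≃ B.Square
  /-- the cell `p` is moved onto the square `square p` -/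
  image_cell : ∀ p : P.Cell, (place p).map '' cellRegion p.1 = (square p).region
  /-- the upper side of the cell points out of the box -/
  outward : ∀ p : P.Cell,
    (place p).u ⨯₃ (place p).v = fun i => ((square p).normal i : ℝ)
  /-- adjacent cells stay attached along their common edge -/
  attached : ∀ p q : P.Cell, P.graph.Adj p q →
    ∀ x ∈ cellRegion p.1 ∩ cellRegion q.1, (place p).map x = (place q).map x

namespace Folding

variable {P : Polyomino} {B : Box}

/-- The cut edges of `B` induced by the folding: the pairs of adjacent squares whose cells are not
adjacent in `P`. -/
def cutEdges (F : Folding P B) : Set (Sym2 B.Square) :=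
  {e | e ∈ B.graph.edgeSet ∧ e.map F.square.symm ∉ P.graph.edgeSet}

/-- The square `s` has orientation `d` in the unfolding: its dot comes from the corner number `d` of
the cell that is folded onto `s`. -/
def HasOrientation (F : Folding P B) (s : B.Square) (d : ZMod 4) : Prop :=
  (F.place (F.square.symm s)).map (cellCorner (F.square.symm s).1 d) = fun i => (s.dot i : ℝ)

end Folding

/-! ### The constraints

Boolean variables are families of propositions. The variable `e_{s,t}`, which is true when the edge
`{s,t}` is not cut, is `s(s, t) ∉ C`, for `C` the set of cut edges. -/

/-- The square orientation constraints on the variables `o_{s,d}`. -/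
structure OrientationConstraints (B : Box) (C : Set (Sym2 B.Square))
    (o : B.Square → ZMod 4 → Prop) : Prop where
  existsUnique : ∀ s, ∃! d, o s d
  relative : ∀ s t r d, s.IsRelOrientation t r → s(s, t) ∉ C → o s d → o t (r + d)

/-- The constraints `EQUIV` for the boxes `B₁`, `B₂` with sets of cut edges `C₁`, `C₂`, orientation
variables `o₁`, `o₂`, mapping variables `m_{s,s'}` (true when `s'` is mapped to `s`) and variables
`ρ_{s,r}` for the change of orientation.

In the constraints `map_neighbor`, `keep` and `keep'`, `s₂` is the neighbor of `s₁` across the edge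
number `k` of `s₁`. If `s₁` has orientation `d`, then `s₂` lies in the direction `k + d` of the
plane; as `s₁'` has orientation `d + r`, its neighbor in that direction is the one across
its edge number `k - r`. -/
structure EQUIV (B₁ B₂ : Box) (C₁ : Set (Sym2 B₁.Square)) (C₂ : Set (Sym2 B₂.Square))
    (o₁ : B₁.Square → ZMod 4 → Prop) (o₂ : B₂.Square → ZMod 4 → Prop)
    (m : B₁.Square → B₂.Square → Prop) (ρ : B₁.Square → ZMod 4 → Prop) : Prop where
  /-- `m` encodes a function from the squares of `B₂` to those of `B₁` -/
  map_function : ∀ s', ∃! s, m s s'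
  /-- the function encoded by `m` is a bijection -/
  map_bijective : ∀ s, ∃! s', m s s'
  /-- `ρ` encodes a function -/
  shift_function : ∀ s, ∃! r, ρ s r
  shift : ∀ s s' d r, m s s' → o₂ s' (d + r) → o₁ s d → ρ s r
  map_neighbor : ∀ s₁ s₂ s₁' s₂' k r, s₁.IsNeighbor k s₂ → s₁'.IsNeighbor (k - r) s₂' →
    m s₁ s₁' → ρ s₁ r → s(s₁, s₂) ∉ C₁ → m s₂ s₂'
  keep : ∀ s₁ s₂ s₁' s₂' k r, s₁.IsNeighbor k s₂ → s₁'.IsNeighbor (k - r) s₂' →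
    m s₁ s₁' → ρ s₁ r → s(s₁, s₂) ∉ C₁ → s(s₁', s₂') ∉ C₂
  keep' : ∀ s₁ s₂ s₁' s₂' k r, s₁.IsNeighbor k s₂ → s₁'.IsNeighbor (k - r) s₂' →
    m s₁ s₁' → ρ s₁ r → s(s₁', s₂') ∉ C₂ → s(s₁, s₂) ∉ C₁

/-! A rigid motion that takes a cell onto a unit square with its upper side outward preserves the
counterclockwise order of corners, so it only shifts their numbers: the corner `d + q` lands on
vertex `q` (`Placement.exists_orientation`), and `d` is the orientation. Hence the edge `a` of a
cell lands on the edge `a - o(s)` of its square `s`, and for cells adjacent in direction `a` this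
edge is the edge `a + 2 - o(t)` of the neighbor `t` (`edge_eq_of_adj`). Two squares share at most
one edge (`edge_number_unique`), so these are the numbers in the relative orientation.

For EQUIV, the edges `k` and `k - r` come from the same edge of one cell. If either is uncut, `P`
has a cell across it, and both foldings put that cell on the unique square across the edge
(`eq_of_edge_eq`). So `s₂` and `s₂'` come from one cell, and being cut means the same in both boxes.
-/

namespace Box.Square

/-! ### Incidence of squares and edges on a box. -/

variable {B : Box}

/-- The frame consists of the basis vectors of the two directions in the plane of the square, in
the order that makes their cross product the outward normal. -/
theorem exists_frame_axes (s : B.Square) : ∃ a b : Fin 3,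
    s.frame = (Pi.single a 1, Pi.single b 1) ∧ a ≠ b ∧ a ≠ s.axis ∧ b ≠ s.axis ∧
    (∀ i, i = s.axis ∨ i = a ∨ i = b) ∧
    ∀ u v : Fin 3 → ℝ, u ⨯₃ v = (fun i => (s.normal i : ℝ)) → u a * v b - u b * v a = 1 := by
  obtain ⟨k, c, h1, h2⟩ := s
  have key : ∀ k : Fin 3, k + 1 ≠ k + 2 ∧ k + 1 ≠ k ∧ k + 2 ≠ k ∧
      ∀ i, i = k ∨ i = k + 1 ∨ i = k + 2 := by decide
  obtain ⟨h21, h1k, h2k, hi⟩ := key k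
  by_cases h : c k = 0
  · refine ⟨k + 2, k + 1, by simp [frame, h], h21.symm, h2k, h1k,
      fun i => (hi i).imp_right Or.symm, ?_⟩
    · intro u v huv
      have := congrFun huv k
      simp only [normal, h, if_true] at this
      fin_cases k <;> simp [cross_apply] at this ⊢ <;> linarith
  · refine ⟨k + 1, k + 2, by simp [frame, h], h21, h1k, h2k, hi, ?_⟩
    · intro u v huv
      have := congrFun huv k
      simp only [normal, h, if_false] at this
      fin_cases k <;> simp [cross_apply] at this ⊢ <;> linarith

/-- Twice the midpoint of the edge number `k`. -/
def edgeSum (s : B.Square) (k : ZMod 4) : Fin 3 → ℤ := s.vertex (k - 1) + s.vertex k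

theorem edgeSum_eq_of_edge_eq {s t : B.Square} {j k : ZMod 4} (h : t.edge j = s.edge k) :
    t.edgeSum j = s.edgeSum k := by
  rcases Sym2.eq_iff.1 h with ⟨h1, h2⟩ | ⟨h1, h2⟩
  · rw [edgeSum, edgeSum, h1, h2]
  · rw [edgeSum, edgeSum, h1, h2, add_comm]

theorem edgeSum_injective (s : B.Square) : Function.Injective s.edgeSum := by
  obtain ⟨a, b, hf, hab, -⟩ := s.exists_frame_axes
  intro k k' h
  have ha := congrFun h a
  have hb := congrFun h b
  simp only [edgeSum, vertex, hf, Pi.add_apply, Pi.smul_apply, Pi.single_eq_same,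
    Pi.single_eq_of_ne hab, Pi.single_eq_of_ne hab.symm, smul_eq_mul, mul_one, mul_zero,
    add_zero] at ha hb
  have ha' : (unitCorner (k - 1)).1 + (unitCorner k).1 =
    (unitCorner (k' - 1)).1 + (unitCorner k').1 := by linarith
  have hb' : (unitCorner (k - 1)).2 + (unitCorner k).2 =
    (unitCorner (k' - 1)).2 + (unitCorner k').2 := by linarith
  clear ha hb h
  revert k k'
  decide

/-- Describing an edge by its doubled midpoint turns incidence into integer linear arithmetic: the
odd coordinate gives the direction of the edge. -/
theorem edgeSum_cases (s : B.Square) (k : ZMod 4) :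
    s.edgeSum k s.axis = 2 * s.corner s.axis ∧
    ((s.edgeSum k (s.axis + 1) = 2 * s.corner (s.axis + 1) + 1 ∧
      (s.edgeSum k (s.axis + 2) = 2 * s.corner (s.axis + 2) ∨
        s.edgeSum k (s.axis + 2) = 2 * s.corner (s.axis + 2) + 2)) ∨
    (s.edgeSum k (s.axis + 2) = 2 * s.corner (s.axis + 2) + 1 ∧
      (s.edgeSum k (s.axis + 1) = 2 * s.corner (s.axis + 1) ∨
        s.edgeSum k (s.axis + 1) = 2 * s.corner (s.axis + 1) + 2))) := by
  have key : ∀ k : ZMod 4,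
      ((unitCorner (k - 1)).1 + (unitCorner k).1 = 1 ∧
        ((unitCorner (k - 1)).2 + (unitCorner k).2 = 0 ∨
          (unitCorner (k - 1)).2 + (unitCorner k).2 = 2)) ∨
      ((unitCorner (k - 1)).2 + (unitCorner k).2 = 1 ∧
        ((unitCorner (k - 1)).1 + (unitCorner k).1 = 0 ∨
          (unitCorner (k - 1)).1 + (unitCorner k).1 = 2)) := by decide
  have := key k
  obtain ⟨i, c, h1, h2⟩ := s
  clear key
  by_cases h : c i = 0 <;> fin_cases i <;>
    simp at h <;> simp [edgeSum, vertex, frame, h] <;> omega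

theorem eq_of_axis_of_corner {s t : B.Square} (h : s.axis = t.axis)
    (h0 : s.corner 0 = t.corner 0) (h1 : s.corner 1 = t.corner 1)
    (h2 : s.corner 2 = t.corner 2) : s = t := by
  refine Box.Square.ext h (funext fun i => ?_)
  fin_cases i <;> assumption

set_option maxHeartbeats 4000000 in
/-- An edge of a square belongs to only one other square. -/
theorem eq_of_edge_eq {s t t' : B.Square} {k j j' : ZMod 4} (hst : s ≠ t) (hst' : s ≠ t')
    (h : t.edge j = s.edge k) (h' : t'.edge j' = s.edge k) : t = t' := by
  -- The axes of the three squares are perpendicular to the edge, so two of them agree; those two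
  -- squares lie on either side of the edge in one face. The edge is then interior to that face,
  -- which excludes a perpendicular square, and a third coplanar square would repeat one of the two.
  have hs := s.edgeSum_cases k
  have ht := t.edgeSum_cases j
  have ht' := t'.edgeSum_cases j'
  rw [edgeSum_eq_of_edge_eq h] at ht
  rw [edgeSum_eq_of_edge_eq h'] at ht'
  generalize s.edgeSum k = m at *
  clear h h'
  by_contra hne
  have e1 := fun a b c d => hst (eq_of_axis_of_corner a b c d)
  have e2 := fun a b c d => hst' (eq_of_axis_of_corner a b c d)
  have e3 := fun a b c d => hne (eq_of_axis_of_corner a b c d)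
  clear hst hst' hne
  obtain ⟨i, c, f, g⟩ := s
  obtain ⟨i', c', f', g'⟩ := t
  obtain ⟨i'', c'', f'', g''⟩ := t'
  have g0 := g 0
  have g1 := g 1
  have g2 := g 2
  have g0' := g' 0
  have g1' := g' 1
  have g2' := g' 2
  have g0'' := g'' 0
  have g1'' := g'' 1
  have g2'' := g'' 2
  dsimp only at *
  clear g g' g''
  fin_cases i <;> fin_cases i' <;> fin_cases i'' <;> simp at * <;> omega

/-- Two distinct squares have at most one common edge. -/
theorem edge_number_unique {s t : B.Square} {k j k' j' : ZMod 4} (hst : s ≠ t)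
    (h : t.edge j = s.edge k) (h' : t.edge j' = s.edge k') : k = k' ∧ j = j' := by
  have hk : k = k' := by
    -- This holds for any lattice squares: distinct coplanar ones share at most an edge, and
    -- perpendicular ones meet within a line, which contains at most one edge of each.
    by_contra hne
    have hm := fun e => hne (s.edgeSum_injective e)
    have hs := s.edgeSum_cases k
    have ht := t.edgeSum_cases j
    have hs' := s.edgeSum_cases k'
    have ht' := t.edgeSum_cases j'
    rw [edgeSum_eq_of_edge_eq h] at ht
    rw [edgeSum_eq_of_edge_eq h'] at ht'
    generalize s.edgeSum k = m at *
    generalize s.edgeSum k' = m' at *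
    have e1 := fun a b c d => hst (eq_of_axis_of_corner a b c d)
    have e2 : ¬ (m 0 = m' 0 ∧ m 1 = m' 1 ∧ m 2 = m' 2) := fun e => hm <| funext fun i => by
      fin_cases i
      exacts [e.1, e.2.1, e.2.2]
    clear hst hne hm h h'
    obtain ⟨i, c, f, g⟩ := s
    obtain ⟨i', c', f', g'⟩ := t
    dsimp only at *
    clear f g f' g'
    fin_cases i <;> fin_cases i' <;> simp at * <;> omega
  subst hk
  exact ⟨rfl, t.edgeSum_injective (by rw [edgeSum_eq_of_edge_eq h, edgeSum_eq_of_edge_eq h'])⟩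

theorem vertex_injective (s : B.Square) : Function.Injective s.vertex := by
  obtain ⟨a, b, hf, hab, -⟩ := s.exists_frame_axes
  intro k k' h
  have ha := congrFun h a
  have hb := congrFun h b
  simp only [vertex, hf, Pi.add_apply, Pi.smul_apply, Pi.single_eq_same,
    Pi.single_eq_of_ne hab, Pi.single_eq_of_ne hab.symm, smul_eq_mul, mul_one, mul_zero,
    add_zero, add_right_inj] at ha hb
  clear h
  revert k k'
  decide

end Box.Square

/-! ### Corners and adjacency of planar cells. -/

theorem cellCorner_mem_cellRegion (p : ℤ × ℤ) (q : ZMod 4) : cellCorner p q ∈ cellRegion p := by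
  have h : ∀ q : ZMod 4, (0 ≤ (unitCorner q).1 ∧ (unitCorner q).1 ≤ 1) ∧
    (0 ≤ (unitCorner q).2 ∧ (unitCorner q).2 ≤ 1) := by decide
  obtain ⟨⟨h1, h2⟩, h3, h4⟩ := h q
  simp only [cellCorner, cellRegion, Set.mem_prod, Set.mem_Icc]
  norm_cast
  omega

/-- The cell `q` shares the edge number `a` of the cell `p`. -/
def IsCellDirection (p q : ℤ × ℤ) (a : ZMod 4) : Prop :=
  cellCorner p a = cellCorner q (a + 1) ∧ cellCorner p (a - 1) = cellCorner q (a + 2)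

theorem exists_isCellDirection {p q : ℤ × ℤ} (h : gridGraph.Adj p q) :
    ∃ a, IsCellDirection p q a := by
  obtain ⟨p1, p2⟩ := p
  obtain ⟨q1, q2⟩ := q
  change |p1 - q1| + |p2 - q2| = 1 at h
  have h' : (q1 = p1 + 1 ∧ q2 = p2) ∨ (q1 = p1 ∧ q2 = p2 + 1) ∨ (q1 = p1 - 1 ∧ q2 = p2) ∨
      (q1 = p1 ∧ q2 = p2 - 1) := by
    rcases abs_cases (p1 - q1) with ⟨_, _⟩ | ⟨_, _⟩ <;>
      rcases abs_cases (p2 - q2) with ⟨_, _⟩ | ⟨_, _⟩ <;> omega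
  have key : ∀ (a : ZMod 4) (x y : ℤ), (unitCorner a).1 = x + (unitCorner (a + 1)).1 →
      (unitCorner a).2 = y + (unitCorner (a + 1)).2 →
      (unitCorner (a - 1)).1 = x + (unitCorner (a + 2)).1 →
      (unitCorner (a - 1)).2 = y + (unitCorner (a + 2)).2 →
      q1 = p1 + x → q2 = p2 + y → IsCellDirection (p1, p2) (q1, q2) a := by
    intro a x y h1 h2 h3 h4 hx hy
    simp only [IsCellDirection, cellCorner, Prod.mk.injEq, Int.cast_inj]
    omega
  rcases h' with ⟨h1, h2⟩ | ⟨h1, h2⟩ | ⟨h1, h2⟩ | ⟨h1, h2⟩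
  · exact ⟨0, key 0 1 0 (by decide) (by decide) (by decide) (by decide) (by omega) (by omega)⟩
  · exact ⟨1, key 1 0 1 (by decide) (by decide) (by decide) (by decide) (by omega) (by omega)⟩
  · exact ⟨2, key 2 (-1) 0 (by decide) (by decide) (by decide) (by decide) (by omega) (by omega)⟩
  · exact ⟨3, key 3 0 (-1) (by decide) (by decide) (by decide) (by decide) (by omega) (by omega)⟩

/-! ### Rigid placements of a cell onto a unit square. -/

/-- A unit square of the plane, rotated by the angle with cosine `x` and sine `y` and contained in
an axis-parallel unit square, is rotated by a multiple of the right angle. -/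
theorem rotation_cases {x y A B a b : ℝ} (hxy : x ^ 2 + y ^ 2 = 1)
    (h00 : A ∈ Set.Icc a (a + 1) ∧ B ∈ Set.Icc b (b + 1))
    (h10 : A + x ∈ Set.Icc a (a + 1) ∧ B + y ∈ Set.Icc b (b + 1))
    (h01 : A - y ∈ Set.Icc a (a + 1) ∧ B + x ∈ Set.Icc b (b + 1))
    (h11 : A + x - y ∈ Set.Icc a (a + 1) ∧ B + y + x ∈ Set.Icc b (b + 1)) :
    (x = 1 ∧ y = 0 ∧ A = a ∧ B = b) ∨ (x = 0 ∧ y = 1 ∧ A = a + 1 ∧ B = b) ∨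
    (x = -1 ∧ y = 0 ∧ A = a + 1 ∧ B = b + 1) ∨ (x = 0 ∧ y = -1 ∧ A = a ∧ B = b + 1) := by
  simp only [Set.mem_Icc] at *
  -- The rotated square has width `|x| + |y|`, which is at most `1`; squaring and using `hxy` gives
  -- `2|xy| ≤ 0`.
  have h0 : x * y = 0 := by
    rcases le_total 0 x with hx | hx <;> rcases le_total 0 y with hy | hy <;> nlinarith
  rcases mul_eq_zero.1 h0 with h | h
  · have : (y - 1) * (y + 1) = 0 := by rw [h] at hxy; linarith
    rcases mul_eq_zero.1 this with h' | h'
    · right; left; refine ⟨h, ?_, ?_, ?_⟩ <;> linarith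
    · right; right; right; refine ⟨h, ?_, ?_, ?_⟩ <;> linarith
  · have : (x - 1) * (x + 1) = 0 := by rw [h] at hxy; linarith
    rcases mul_eq_zero.1 this with h' | h'
    · left; refine ⟨?_, h, ?_, ?_⟩ <;> linarith
    · right; right; left; refine ⟨?_, h, ?_, ?_⟩ <;> linarith

namespace Placement

/-- The lower left corner of the cell `p`, placed in space. -/
def base (T : Placement) (p : ℤ × ℤ) : Fin 3 → ℝ := T.map ((p.1 : ℝ), (p.2 : ℝ))

theorem map_cellCorner (T : Placement) (p : ℤ × ℤ) (q : ZMod 4) (i : Fin 3) :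
    T.map (cellCorner p q) i =
      T.base p i + ((unitCorner q).1 : ℝ) * T.u i + ((unitCorner q).2 : ℝ) * T.v i := by
  simp only [base, map, cellCorner, Pi.add_apply, Pi.smul_apply, smul_eq_mul]
  push_cast
  ring

/-- A placement that moves a cell into a square of the box, with the upper side outside, rotates
the numbering of the corners. -/
theorem exists_orientation {B : Box} (T : Placement) (p : ℤ × ℤ) (s : B.Square)
    (him : ∀ q, T.map (cellCorner p q) ∈ s.region)
    (hout : T.u ⨯₃ T.v = fun i => (s.normal i : ℝ)) :
    ∃ d, ∀ q, T.map (cellCorner p (d + q)) = fun i => (s.vertex q i : ℝ) := by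
  obtain ⟨a, b, hf, hab, ha, hb, hcases, hcross⟩ := s.exists_frame_axes
  have hdet := hcross _ _ hout
  have e : ∀ x y : Fin 3 → ℝ, x ⬝ᵥ y = x s.axis * y s.axis + x a * y a + x b * y b := by
    intro x y
    have hu : (Finset.univ : Finset (Fin 3)) = {s.axis, a, b} := by
      ext i; simpa using hcases i
    rw [dotProduct, hu, Finset.sum_insert (by simp [ha.symm, hb.symm]),
      Finset.sum_insert (by simp [hab]), Finset.sum_singleton, add_assoc]
  have c0 := him 0
  have c1 := him 1
  have c2 := him 2
  have c3 := him 3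
  simp only [Box.Square.region, Set.mem_ofPred_eq, map_cellCorner] at c0 c1 c2 c3
  have n0 : unitCorner 0 = (1, 1) := by decide
  have n1 : unitCorner 1 = (0, 1) := by decide
  have n2 : unitCorner 2 = (0, 0) := by decide
  have n3 : unitCorner 3 = (1, 0) := by decide
  simp only [n0, n1, n2, n3, Int.cast_zero, Int.cast_one, one_mul, zero_mul, add_zero]
    at c0 c1 c2 c3
  have hu0 : T.u s.axis = 0 := by linarith [c3.1, c2.1]
  have hv0 : T.v s.axis = 0 := by linarith [c1.1, c2.1]
  have huu := T.u_unit
  have huv := T.u_orth_v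
  rw [e, hu0] at huu huv
  -- Orthogonality and determinant `1` force `v` to be `u` turned by a right angle.
  have hva : T.v a = -T.u b := by
    linear_combination (-T.v a) * huu + T.u a * huv - T.u b * hdet
  have hvb : T.v b = T.u a := by
    linear_combination (-T.v b) * huu + T.u b * huv + T.u a * hdet
  have hrot := rotation_cases (x := T.u a) (y := T.u b) (A := T.base p a) (B := T.base p b)
    (a := s.corner a) (b := s.corner b) (by linarith) ⟨c2.2 a ha, c2.2 b hb⟩
    ⟨c3.2 a ha, c3.2 b hb⟩
    (by have h1 := c1.2 a ha
        have h2 := c1.2 b hb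
        rw [hva] at h1
        rw [hvb] at h2
        exact ⟨by rwa [sub_eq_add_neg], h2⟩)
    (by have h1 := c0.2 a ha
        have h2 := c0.2 b hb
        rw [hva] at h1
        rw [hvb] at h2
        exact ⟨by rwa [sub_eq_add_neg], h2⟩)
  have key : ∀ d q : ZMod 4,
      T.base p a + (unitCorner (d + q)).1 * T.u a + (unitCorner (d + q)).2 * -T.u b =
        s.corner a + (unitCorner q).1 →
      T.base p b + (unitCorner (d + q)).1 * T.u b + (unitCorner (d + q)).2 * T.u a =
        s.corner b + (unitCorner q).2 →
      T.map (cellCorner p (d + q)) = fun i => (s.vertex q i : ℝ) := by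
    intro d q h1 h2
    funext i
    rw [map_cellCorner, Box.Square.vertex, hf]
    rcases hcases i with rfl | rfl | rfl
    · simp [hu0, hv0, c2.1, Pi.single_eq_of_ne ha.symm, Pi.single_eq_of_ne hb.symm]
    · simp [hva, Pi.single_eq_of_ne hab, ← h1]
    · simp [hvb, Pi.single_eq_of_ne hab.symm, ← h2]
  have four : ∀ q : ZMod 4, q = 0 ∨ q = 1 ∨ q = 2 ∨ q = 3 := by decide
  -- After `n` counterclockwise quarter turns the corner at the dot is number `-n`, hence `0, 3, 2,
  -- 1`.
  rcases hrot with ⟨h1, h2, h3, h4⟩ | ⟨h1, h2, h3, h4⟩ | ⟨h1, h2, h3, h4⟩ | ⟨h1, h2, h3, h4⟩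
  · refine ⟨0, fun q => key 0 q ?_ ?_⟩ <;> simp [h1, h2, h3, h4]
  · have r : ∀ q : ZMod 4, (unitCorner (3 + q)).1 = (unitCorner q).2 ∧
      (unitCorner (3 + q)).2 = 1 - (unitCorner q).1 := by decide
    refine ⟨3, fun q => key 3 q ?_ ?_⟩ <;> simp [h1, h2, h3, h4, r]
  · have r : ∀ q : ZMod 4, (unitCorner (2 + q)).1 = 1 - (unitCorner q).1 ∧
      (unitCorner (2 + q)).2 = 1 - (unitCorner q).2 := by decide
    refine ⟨2, fun q => key 2 q ?_ ?_⟩ <;> simp [h1, h2, h3, h4, r]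
  · have r : ∀ q : ZMod 4, (unitCorner (1 + q)).1 = 1 - (unitCorner q).2 ∧
      (unitCorner (1 + q)).2 = (unitCorner q).1 := by decide
    refine ⟨1, fun q => key 1 q ?_ ?_⟩ <;> simp [h1, h2, h3, h4, r]

end Placement

/-! ### Orientations and cut edges of a folding. -/

namespace Folding

variable {P : Polyomino} {B : Box}

theorem exists_orientation (F : Folding P B) (s : B.Square) :
    ∃ d, ∀ q, (F.place (F.square.symm s)).map (cellCorner (F.square.symm s).1 (d + q)) =
      fun i => (s.vertex q i : ℝ) := by
  have h := F.image_cell (F.square.symm s)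
  have h' := F.outward (F.square.symm s)
  rw [Equiv.apply_symm_apply] at h h'
  exact Placement.exists_orientation _ _ s
    (fun q => h ▸ Set.mem_image_of_mem _ (cellCorner_mem_cellRegion _ q)) h'

/-- The orientation of a square in the unfolding. -/
noncomputable def orientation (F : Folding P B) (s : B.Square) : ZMod 4 :=
  (F.exists_orientation s).choose

theorem map_cellCorner (F : Folding P B) (s : B.Square) (q : ZMod 4) :
    (F.place (F.square.symm s)).map (cellCorner (F.square.symm s).1 q) =
      fun i => (s.vertex (q - F.orientation s) i : ℝ) := by
  have := (F.exists_orientation s).choose_spec (q - F.orientation s)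
  rwa [← orientation, add_sub_cancel] at this

/-- The four vertices are distinct and the dot is `vertex 0`, so the choice made in `orientation` is
forced. -/
theorem hasOrientation_iff (F : Folding P B) (s : B.Square) (d : ZMod 4) :
    F.HasOrientation s d ↔ F.orientation s = d := by
  rw [HasOrientation, map_cellCorner, ← s.vertex_zero]
  constructor
  · intro h
    have h' : s.vertex (d - F.orientation s) = s.vertex 0 :=
      funext fun i => Int.cast_injective (congrFun h i)
    exact (sub_eq_zero.1 (s.vertex_injective h')).symm
  · rintro rfl
    rw [sub_self]

/-- Adjacent cells stay attached: the squares of two cells share the edge along which the cells are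
adjacent. -/
theorem edge_eq_of_adj (F : Folding P B) {s t : B.Square} {a : ZMod 4}
    (h : P.graph.Adj (F.square.symm s) (F.square.symm t))
    (ha : IsCellDirection (F.square.symm s).1 (F.square.symm t).1 a) :
    t.edge (a + 2 - F.orientation t) = s.edge (a - F.orientation s) := by
  have glue : ∀ x y, cellCorner (F.square.symm s).1 x = cellCorner (F.square.symm t).1 y →
      s.vertex (x - F.orientation s) = t.vertex (y - F.orientation t) := by
    intro x y hxy
    have := F.attached _ _ h (cellCorner (F.square.symm s).1 x)
      ⟨cellCorner_mem_cellRegion _ _, hxy ▸ cellCorner_mem_cellRegion _ _⟩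
    rw [map_cellCorner, hxy, map_cellCorner] at this
    exact funext fun i => Int.cast_injective (congrFun this i)
  have h1 := glue _ _ ha.1
  have h2 := glue _ _ ha.2
  -- Both boundaries run counterclockwise, so the common edge is traversed in opposite directions;
  -- hence the swap.
  rw [Box.Square.edge, Box.Square.edge, h1, show a - F.orientation s - 1 =
    a - 1 - F.orientation s by ring, h2, Sym2.eq_swap, show a + 2 - F.orientation t - 1 =
    a + 1 - F.orientation t by ring]

theorem adj_of_notMem_cutEdges (F : Folding P B) {s t : B.Square} (h : B.graph.Adj s t)
    (hC : s(s, t) ∉ F.cutEdges) : P.graph.Adj (F.square.symm s) (F.square.symm t) := by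
  by_contra hP
  exact hC ⟨h, hP⟩

theorem notMem_cutEdges_of_adj (F : Folding P B) {s t : B.Square}
    (h : P.graph.Adj (F.square.symm s) (F.square.symm t)) : s(s, t) ∉ F.cutEdges :=
  fun hC => hC.2 h

theorem orientationConstraints (F : Folding P B) :
    OrientationConstraints B F.cutEdges (fun s d => F.orientation s = d) where
  existsUnique s := ⟨_, rfl, fun _ h => h.symm⟩
  relative := by
    rintro s t r d ⟨hne, k, j, he, rfl⟩ hC rfl
    have hadj := F.adj_of_notMem_cutEdges ⟨hne, k, j, he⟩ hC
    obtain ⟨a, ha⟩ := exists_isCellDirection hadj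
    -- Now `k = a - o(s)` and `j = a + 2 - o(t)`, so the planar direction `a` cancels in `k + 2 -
    -- j`.
    obtain ⟨rfl, rfl⟩ := Box.Square.edge_number_unique hne he (F.edge_eq_of_adj hadj ha)
    ring

/-- If the edge numbers `k` of `s` and `k'` of `s'` come from the same edge of a cell, and the edge
`k` is not cut, then the neighbors across these edges come from the same cell. -/
theorem symm_eq_of_isNeighbor {B' : Box} (F : Folding P B) (G : Folding P B')
    {s t : B.Square} {s' t' : B'.Square} {k k' : ZMod 4}
    (hs : F.square.symm s = G.square.symm s')
    (hk : k + F.orientation s = k' + G.orientation s')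
    (ht : s.IsNeighbor k t) (ht' : s'.IsNeighbor k' t') (hC : s(s, t) ∉ F.cutEdges) :
    F.square.symm t = G.square.symm t' := by
  obtain ⟨hne, j, he⟩ := ht
  obtain ⟨hne', j', he'⟩ := ht'
  have hadj := F.adj_of_notMem_cutEdges ⟨hne, k, j, he⟩ hC
  obtain ⟨a, ha⟩ := exists_isCellDirection hadj
  obtain ⟨rfl, -⟩ := Box.Square.edge_number_unique hne he (F.edge_eq_of_adj hadj ha)
  -- `x` is where `G` puts the cell of `t`. Adjacency in `P` makes `x` share the edge `k'` with
  -- `s'`, so `x = t'`.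
  obtain ⟨x, hx⟩ : ∃ x, F.square.symm t = G.square.symm x :=
    ⟨G.square (F.square.symm t), (G.square.symm_apply_apply _).symm⟩
  rw [hs, hx] at hadj ha
  have hnx : s' ≠ x := by
    rintro rfl
    exact P.graph.loopless.irrefl _ hadj
  have hx' := G.edge_eq_of_adj hadj ha
  rw [show a - G.orientation s' = k' by linear_combination hk] at hx'
  rw [hx, Box.Square.eq_of_edge_eq hnx hne' hx' he']

end Folding

/-! ### The constraints for two foldings of one polyomino. -/

theorem mainTheorem6 (P : Polyomino) (B₁ B₂ : Box) (F₁ : Folding P B₁) (F₂ : Folding P B₂) :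
    ∃ (o₁ : B₁.Square → ZMod 4) (o₂ : B₂.Square → ZMod 4)
      (M : B₂.Square ≃ B₁.Square) (ρ : B₁.Square → ZMod 4),
      (∀ s d, F₁.HasOrientation s d ↔ o₁ s = d) ∧
      (∀ s' d, F₂.HasOrientation s' d ↔ o₂ s' = d) ∧
      (∀ s', M s' = F₁.square (F₂.square.symm s')) ∧
      (∀ s', ρ (M s') = o₂ s' - o₁ (M s')) ∧
      OrientationConstraints B₁ F₁.cutEdges (fun s d => o₁ s = d) ∧
      OrientationConstraints B₂ F₂.cutEdges (fun s' d => o₂ s' = d) ∧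
      EQUIV B₁ B₂ F₁.cutEdges F₂.cutEdges (fun s d => o₁ s = d) (fun s' d => o₂ s' = d)
        (fun s s' => M s' = s) (fun s r => ρ s = r) := by
  refine ⟨F₁.orientation, F₂.orientation, F₂.square.symm.trans F₁.square,
    fun s => F₂.orientation (F₂.square (F₁.square.symm s)) - F₁.orientation s,
    F₁.hasOrientation_iff, F₂.hasOrientation_iff, fun _ => rfl, fun s' => by simp,
    F₁.orientationConstraints, F₂.orientationConstraints, ?_⟩
  have mapped : ∀ s s', (F₂.square.symm.trans F₁.square) s' = s ↔
      F₁.square.symm s = F₂.square.symm s' := fun s s' => by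
    rw [Equiv.trans_apply, Equiv.symm_apply_eq, eq_comm]
  -- The two foldings play symmetric roles, so an uncut edge in either box suffices; all three
  -- neighbor constraints rest on this.
  have cells : ∀ {s₁ s₂ s₁' s₂' k r}, s₁.IsNeighbor k s₂ → s₁'.IsNeighbor (k - r) s₂' →
      F₁.square.symm s₁ = F₂.square.symm s₁' →
      F₂.orientation (F₂.square (F₁.square.symm s₁)) - F₁.orientation s₁ = r →
      s(s₁, s₂) ∉ F₁.cutEdges ∨ s(s₁', s₂') ∉ F₂.cutEdges →
      F₁.square.symm s₂ = F₂.square.symm s₂' := by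
    intro s₁ s₂ s₁' s₂' k r hn hn' hm hr hC
    rw [hm, Equiv.apply_symm_apply] at hr
    rcases hC with hC | hC
    · exact F₁.symm_eq_of_isNeighbor F₂ hm (by rw [← hr]; ring) hn hn' hC
    · exact (F₂.symm_eq_of_isNeighbor F₁ hm.symm (by rw [← hr]; ring) hn' hn hC).symm
  exact
    { map_function := fun s' => ⟨_, rfl, fun _ h => h.symm⟩
      map_bijective := fun s => (F₂.square.symm.trans F₁.square).bijective.existsUnique s
      shift_function := fun s => ⟨_, rfl, fun _ h => h.symm⟩
      shift := by
        rintro s s' d r rfl h rfl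
        simp [h]
      map_neighbor := fun s₁ s₂ s₁' s₂' k r hn hn' hm hr hC =>
        (mapped _ _).2 (cells hn hn' ((mapped _ _).1 hm) hr (.inl hC))
      keep := fun s₁ s₂ s₁' s₂' k r hn hn' hm hr hC => by
        have hadj := F₁.adj_of_notMem_cutEdges ⟨hn.1, k, hn.2⟩ hC
        -- Both edges now stand for the same pair of cells of `P`, whose adjacency decides both
        -- cuts.
        rw [(mapped _ _).1 hm, cells hn hn' ((mapped _ _).1 hm) hr (.inl hC)] at hadj
        exact F₂.notMem_cutEdges_of_adj hadj
      keep' := fun s₁ s₂ s₁' s₂' k r hn hn' hm hr hC => by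
        have hadj := F₂.adj_of_notMem_cutEdges ⟨hn'.1, k - r, hn'.2⟩ hC
        rw [← (mapped _ _).1 hm, ← cells hn hn' ((mapped _ _).1 hm) hr (.inr hC)] at hadj
        exact F₁.notMem_cutEdges_of_adj hadj }
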